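/- Let $\sigma=(\sigma_1,\sigma_2,\sigma_3)$ be the Pauli matrices and let $A=a_0\mathbb 1+\mathbf a\cdot\sigma$, $B=b_0\mathbb 1+\mathbf b\cdot\sigma$, $C=c_0\mathbb 1+\mathbf c\cdot\sigma$ be three qubit observables with $a_0,b_0,c_0\in\mathbb R$ and nonzero $\mathbf a,\mathbf b,\mathbf c\in\mathbb R^3$; put $a=|\mathbf a|$, $b=|\mathbf b|$, $c=|\mathbf c|$. Let $\psi$ be a Haar-distributed random pure state on $\mathbb C^2$ (uniform on the unit sphere), with law $\mu$, and let $\langle X\rangle_\psi=\langle\psi|X|\psi\rangle$ and $\Delta_\psi X=\sqrt{\langle X^2\rangle_\psi-\langle X\rangle_\psi^2}$. Let $$f_{\langle A\rangle,\langle B\rangle,\langle C\rangle}(r,s,t)=\int\delta(r-\langle A\rangle_\psi)\,\delta(s-\langle B\rangle_\psi)\,\delta(t-\langle C\rangle_\psi)\,d\mu(\psi),$$ $$f_{\Delta A,\Delta B,\Delta C}(x,y,z)=\int\delta(x-\Delta_\psi A)\,\delta(y-\Delta_\psi B)\,\delta(z-\Delta_\psi C)\,d\mu(\psi)$$ be the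 joint probability densities of the expectation values and of the uncertainties. These are generalized densities on $\mathbb R^3$, i.e. measures (the laws of the respective random vectors), and the identities below are identities of generalized densities; $u\circ\Phi$, for a generalized density $u$ and a diffeomorphism $\Phi$ of an open set $U$ onto its image, denotes the usual pullback: $u|_{\Phi(U)}$, transported to $U$ by $\Phi^{-1}$ and divided by $|\det D\Phi|$. Set $$r_\pm(x)=a_0\pm\sqrt{a^2-x^2},\qquad s_\pm(y)=b_0\pm\sqrt{b^2-y^2},\qquad t_\pm(z)=c_0\pm\sqrt{c^2-z^2}.$$ Then on $U=(0,a)\times(0,b)\times(0,c)$ $$f_{\Delta A,\Delta B,\Delta C}(x,y,z)=\frac{2xyz}{\sqrt{(a^2-x^2)(b^2-y^2)(c^2-z^2)}}\sum_{j,k\in\{\pm\}}f_{\langle A\rangle,\langle B\rangle,\langle C\rangle}\bigl(r_+(x),s_j(y),t_k(z)\bigr),$$ and $f_{\Delta A,\Delta B,\Delta C}$ gives no mass to the complement of $U$. Moreover, if $\mathbf a,\mathbf b,\mathbf c$ are linearly independent, with Gram matrix $T$, then $$f_{\langle A\rangle,\langle B\rangle,\langle C\rangle}(r,s,t)=\frac{1}{4\pi\sqrt{\det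 T}}\,\delta\bigl(1-\omega(r,s,t)\bigr),\qquad \omega(r,s,t)=\sqrt{v^{\mathsf T}T^{-1}v},\quad v=(r-a_0,\,s-b_0,\,t-c_0)^{\mathsf T},$$ where $\delta(g)$ denotes the measure that is the limit, as $\varepsilon\downarrow0$, of $(2\varepsilon)^{-1}\mathbf 1_{\{|g|<\varepsilon\}}\,dr\,ds\,dt$ tested against continuous functions of compact support. -/

import Mathlib

open MeasureTheory Filter Topology Matrix

noncomputable section

/-! ### Qubit observables and random pure states -/

/-- The Hilbert space `ℂ²` of a qubit. -/
abbrev Qubit : Type := EuclideanSpace ℂ (Fin 2)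

/-- The Pauli matrices `σ₁, σ₂, σ₃` (indexed from `0`). -/
def pauli : Fin 3 → Matrix (Fin 2) (Fin 2) ℂ :=
  ![!![0, 1; 1, 0], !![0, -Complex.I; Complex.I, 0], !![1, 0; 0, -1]]

/-- The qubit observable `a₀ 𝟙 + a · σ`. -/
def qubitObs (a₀ : ℝ) (a : EuclideanSpace ℝ (Fin 3)) : Matrix (Fin 2) (Fin 2) ℂ :=
  (a₀ : ℂ) • (1 : Matrix (Fin 2) (Fin 2) ℂ) + ∑ i, (a i : ℂ) • pauli i

/-- The expectation value `⟨A⟩_ψ = ⟨ψ| A |ψ⟩` (which is real for Hermitian `A`). -/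
def expectation (A : Matrix (Fin 2) (Fin 2) ℂ) (ψ : Qubit) : ℝ :=
  (inner ℂ ψ (Matrix.toEuclideanCLM (n := Fin 2) (𝕜 := ℂ) A ψ)).re

/-- The uncertainty (standard deviation) `Δ_ψ A = √(⟨A²⟩_ψ - ⟨A⟩_ψ²)`. -/
def uncertainty (A : Matrix (Fin 2) (Fin 2) ℂ) (ψ : Qubit) : ℝ :=
  √(expectation (A ^ 2) ψ - expectation A ψ ^ 2)

/-- The law of a Haar-distributed random pure state: the normalized surface measure on the unit
sphere of `ℂ²`. -/
def haarState : Measure (Metric.sphere (0 : Qubit) 1) :=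
  ((volume : Measure Qubit).toSphere Set.univ)⁻¹ • (volume : Measure Qubit).toSphere

/-! ### Generalized densities on `ℝ³`

The densities in question are generalized functions: some of them are carried by a surface. A
(nonnegative) generalized density `u(x, y, z)` is represented by the measure
`u(x, y, z) dx dy dz`; an ordinary function `f` corresponds to `volume.withDensity f`, and the
product of the generalized density `u` with a function `h` is `u.withDensity h`. -/

/-- The joint density `∫ δ(x - X ψ) δ(y - Y ψ) δ(z - Z ψ) dμ(ψ)` of three functions of a
Haar-distributed pure state `ψ`. -/
def jointDensity (X Y Z : Qubit → ℝ) : Measure (ℝ × ℝ × ℝ) :=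
  haarState.map (fun ψ : Metric.sphere (0 : Qubit) 1 => (X ψ, Y ψ, Z ψ))

/-- The joint density `f_{⟨A⟩,⟨B⟩,⟨C⟩}` of the expectation values. -/
def meanDensity (A B C : Matrix (Fin 2) (Fin 2) ℂ) : Measure (ℝ × ℝ × ℝ) :=
  jointDensity (expectation A) (expectation B) (expectation C)

/-- The joint density `f_{ΔA,ΔB,ΔC}` of the uncertainties. -/
def uncertaintyDensity (A B C : Matrix (Fin 2) (Fin 2) ℂ) : Measure (ℝ × ℝ × ℝ) :=
  jointDensity (uncertainty A) (uncertainty B) (uncertainty C)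

/-- The generalized density `p ↦ u (Φ p)` on `U` (and `0` off `U`), where `Φ` is a diffeomorphism
of the open set `U` onto its image: the transport of `u` from `Φ(U)` to `U`, divided by the Jacobian
`|det DΦ|`. If `u` is an ordinary function `f`, this is the function `f ∘ Φ` on `U`. -/
def substDensity (u : Measure (ℝ × ℝ × ℝ)) (U : Set (ℝ × ℝ × ℝ))
    (Φ : ℝ × ℝ × ℝ → ℝ × ℝ × ℝ) : Measure (ℝ × ℝ × ℝ) :=
  ((u.comap (fun p : U => Φ p)).map Subtype.val).withDensity
    (fun p => ENNReal.ofReal |(fderiv ℝ Φ p).det|⁻¹)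

/-- The measure `ν` is the generalized density `δ(g(r, s, t))`, that is, the limit, tested against
continuous functions of compact support, of `(2ε)⁻¹ 1_{|g| < ε}` as `ε ↓ 0`. -/
structure IsDeltaComp (g : ℝ × ℝ × ℝ → ℝ) (ν : Measure (ℝ × ℝ × ℝ)) : Prop where
  isLocallyFinite : IsLocallyFiniteMeasure ν
  tendsto : ∀ φ : ℝ × ℝ × ℝ → ℝ, Continuous φ → HasCompactSupport φ →
    Tendsto (fun ε : ℝ => (2 * ε)⁻¹ * ∫ p in {p | |g p| < ε}, φ p) (𝓝[>] 0) (𝓝 (∫ p, φ p ∂ν))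

/-! ### The explicit quantities -/

/-- The Gram matrix `T_{a,b,c}`. -/
def gramABC (a b c : EuclideanSpace ℝ (Fin 3)) : Matrix (Fin 3) (Fin 3) ℝ :=
  !![inner ℝ a a, inner ℝ a b, inner ℝ a c;
     inner ℝ b a, inner ℝ b b, inner ℝ b c;
     inner ℝ c a, inner ℝ c b, inner ℝ c c]

/-- `ω_{A,B,C}(r, s, t) = √((r-a₀, s-b₀, t-c₀) T⁻¹ (r-a₀, s-b₀, t-c₀)ᵀ)`. -/
def omegaABC (a₀ b₀ c₀ : ℝ) (a b c : EuclideanSpace ℝ (Fin 3)) (p : ℝ × ℝ × ℝ) : ℝ :=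
  √(![p.1 - a₀, p.2.1 - b₀, p.2.2 - c₀] ⬝ᵥ
    ((gramABC a b c)⁻¹ *ᵥ ![p.1 - a₀, p.2.1 - b₀, p.2.2 - c₀]))

/-- `m₀ ± √(m² - x²)`: this is `r_±(x)`, `s_±(x)`, `t_±(x)` for `(m₀, m) = (a₀, |a|)`, `(b₀, |b|)`,
`(c₀, |c|)`. -/
def branch (m₀ m : ℝ) (ε : ℤˣ) (x : ℝ) : ℝ :=
  m₀ + ((ε : ℤ) : ℝ) * √(m ^ 2 - x ^ 2)

end

/-!
The expectation value of `a₀ 𝟙 + a · σ` in a pure state `ψ` is `a₀ + a · n`, and its uncertainty is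
`√(|a|² - (a · n)²)`, where `n` is the Bloch vector of `ψ`. Both joint densities are therefore images of
the law of `n`, and everything rests on the fact that `n` is uniformly distributed on the unit sphere of
`ℝ³` (`blochLaw_eq`). This is deduced from a change of variables in `ℂ²`: the Hopf map carries
`‖ψ‖² dψ` to a multiple of Lebesgue measure on `ℝ³` (`lintegral_comp_bloch`), and polar coordinates on
both sides turn this into a statement about the spheres.

For the uncertainties, the map from expectation values to uncertainties has eight inverse branches over
the open box, one for each choice of the signs of `a · n`, `b · n`, `c · n`. The explicit factor in the
formula is twice the Jacobian of each branch (`jacobian_mul_spreadWeight`), so the right-hand side is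
twice the probability that `a · n > 0`, restricted to the given uncertainties. The symmetry `n ↦ -n`
makes this the full probability (`uncertaintyDensity_formula`). The uncertainties lie in the open box
almost surely because planes and lines through the origin are null for the uniform law.

If `a, b, c` are linearly independent, `n ↦ (a₀ + a · n, b₀ + b · n, c₀ + c · n)` is an affine
isomorphism with Jacobian `√(det T)`, and `ω` is the norm of its inverse (`omegaABC_meanVec`). Hence
`δ(1 - ω)` is `√(det T)` times the image of `δ(1 - |n|)`, which is the surface measure of the unit
sphere (`tendsto_integral_shell`), of total mass `4π`.
-/

noncomputable section

open Set

/-! ### Qubit observables and the Bloch vector -/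

/-- The Bloch vector `(⟨σ₁⟩_ψ, ⟨σ₂⟩_ψ, ⟨σ₃⟩_ψ)` of a vector `ψ ∈ ℂ²`, not necessarily normalized: the
Hopf map, which is homogeneous of degree two. -/
def bloch (ψ : Qubit) : EuclideanSpace ℝ (Fin 3) :=
  !₂[2 * (star (ψ 0) * ψ 1).re, 2 * (star (ψ 0) * ψ 1).im, ‖ψ 0‖ ^ 2 - ‖ψ 1‖ ^ 2]

lemma norm_bloch (ψ : Qubit) : ‖bloch ψ‖ = ‖ψ‖ ^ 2 := by
  rw [← sq_eq_sq₀ (norm_nonneg _) (by positivity), EuclideanSpace.norm_sq_eq,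
    EuclideanSpace.norm_sq_eq]
  simp [bloch, Fin.sum_univ_succ, ← Complex.normSq_eq_norm_sq, Complex.normSq_apply]
  ring

lemma expectation_qubitObs (a₀ : ℝ) (a : EuclideanSpace ℝ (Fin 3)) (ψ : Qubit) :
    expectation (qubitObs a₀ a) ψ = a₀ * ‖ψ‖ ^ 2 + inner ℝ a (bloch ψ) := by
  rw [EuclideanSpace.norm_sq_eq]
  simp [expectation, qubitObs, pauli, bloch, PiLp.inner_apply, Fin.sum_univ_succ, Matrix.mulVec,
    dotProduct, ← Complex.normSq_eq_norm_sq, Complex.normSq_apply, Matrix.one_apply]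
  ring

/-- The square is again a qubit observable, because `(a · σ)² = |a|² 𝟙`. -/
lemma qubitObs_sq (a₀ : ℝ) (a : EuclideanSpace ℝ (Fin 3)) :
    qubitObs a₀ a ^ 2 = qubitObs (a₀ ^ 2 + ‖a‖ ^ 2) ((2 * a₀) • a) := by
  rw [EuclideanSpace.norm_sq_eq, qubitObs, qubitObs, Matrix.one_fin_two, Fin.sum_univ_three,
    Fin.sum_univ_three, Fin.sum_univ_three]
  ext i j
  fin_cases i <;> fin_cases j <;>
  · simp [pauli, pow_two, Matrix.mul_apply, Fin.sum_univ_succ]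
    ring_nf
    try simp [Complex.I_sq]
    try ring

lemma uncertainty_qubitObs (a₀ : ℝ) (a : EuclideanSpace ℝ (Fin 3)) {ψ : Qubit} (hψ : ‖ψ‖ = 1) :
    uncertainty (qubitObs a₀ a) ψ = √(‖a‖ ^ 2 - inner ℝ a (bloch ψ) ^ 2) := by
  rw [uncertainty, qubitObs_sq, expectation_qubitObs, expectation_qubitObs, hψ, inner_smul_left]
  congr 1
  simp
  ring

lemma bloch_smul (r : ℝ) (ψ : Qubit) : bloch (r • ψ) = r ^ 2 • bloch ψ := by
  ext i
  fin_cases i <;> simp [bloch, mul_pow] <;> ring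

lemma continuous_bloch : Continuous bloch := by
  unfold bloch
  refine (PiLp.continuous_toLp 2 _).comp (continuous_pi fun i => ?_)
  fin_cases i <;> simp <;> fun_prop

/-! ### Integration in coordinates on `ℝ³` and `ℂ²` -/

lemma volume_preserving_coord3 : MeasurePreserving
    (fun x : EuclideanSpace ℝ (Fin 3) => (x 0, x 1, x 2)) volume volume := by
  have h1 := PiLp.volume_preserving_ofLp (Fin 3)
  have h2 := volume_preserving_piFinSuccAbove (fun _ : Fin 3 => ℝ) 0
  have h3 := (MeasurePreserving.id (volume : Measure ℝ)).prod (volume_preserving_finTwoArrow ℝ)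
  exact h3.comp (h2.comp h1)

/-- Integration over `ℝ³`, seen as `ℂ × ℝ`. -/
lemma lintegral_euclidean_three (g : EuclideanSpace ℝ (Fin 3) → ENNReal) (hg : Measurable g) :
    ∫⁻ y, g y = ∫⁻ u : ℂ, ∫⁻ t : ℝ, g !₂[u.re, u.im, t] := by
  have h1 := volume_preserving_coord3
  have hm : Measurable (fun p : ℝ × ℝ × ℝ => g !₂[p.1, p.2.1, p.2.2]) := by
    refine hg.comp ((PiLp.continuous_toLp 2 _).measurable.comp (measurable_pi_lambda _ fun i => ?_))
    fin_cases i <;> simp <;> fun_prop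
  have h2 : ∫⁻ y, g y = ∫⁻ p : ℝ × ℝ × ℝ, g !₂[p.1, p.2.1, p.2.2] := by
    rw [← h1.lintegral_comp hm]
    refine lintegral_congr fun y => ?_
    congr 1
    ext i; fin_cases i <;> rfl
  have h3 : MeasurePreserving (fun p : ℂ × ℝ => (p.1.re, p.1.im, p.2)) volume volume :=
    volume_preserving_prodAssoc.comp (Complex.volume_preserving_equiv_real_prod.prod
      (MeasurePreserving.id (volume : Measure ℝ)))
  rw [h2, ← h3.lintegral_comp hm]
  exact lintegral_prod _ (hm.comp h3.measurable).aemeasurable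

/-- The canonical real-linear isometry between the Hilbert sum `ℂ ⊕ ℂ` and the qubit space. -/
def qubitProd : WithLp 2 (ℂ × ℂ) ≃ₗᵢ[ℝ] Qubit where
  toFun p := !₂[p.fst, p.snd]
  invFun ψ := WithLp.toLp 2 (ψ 0, ψ 1)
  map_add' p q := by ext i; fin_cases i <;> simp
  map_smul' r p := by ext i; fin_cases i <;> simp
  left_inv p := by rfl
  right_inv p := by ext i; fin_cases i <;> simp
  norm_map' p := by
    rw [← sq_eq_sq₀ (norm_nonneg _) (norm_nonneg _), WithLp.prod_norm_sq_eq_of_L2,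
      EuclideanSpace.norm_sq_eq, Fin.sum_univ_two]
    rfl

lemma lintegral_qubit (g : Qubit → ENNReal) (hg : Measurable g) :
    ∫⁻ ψ, g ψ = ∫⁻ z : ℂ, ∫⁻ w : ℂ, g !₂[z, w] := by
  have h := (qubitProd.measurePreserving).comp (WithLp.volume_preserving_toLp (U := ℂ) (V := ℂ))
  rw [← h.lintegral_comp hg]
  exact lintegral_prod _ (hg.comp h.measurable).aemeasurable

/-! ### The image of Lebesgue measure under the Hopf map -/

lemma lintegral_comp_complex_mul {c : ℂ} (hc : c ≠ 0) (F : ℂ → ENNReal) (hF : Measurable F) :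
    ∫⁻ w : ℂ, F (c * w) = ENNReal.ofReal (‖c‖ ^ 2)⁻¹ * ∫⁻ u, F u := by
  have hd : LinearMap.det (LinearMap.mul ℝ ℂ c) = ‖c‖ ^ 2 := by
    have := Algebra.norm_complex_apply c
    rw [Algebra.norm_apply] at this
    rw [← Complex.normSq_eq_norm_sq]
    exact this
  have h := Measure.map_linearMap_addHaar_eq_smul_addHaar (volume : Measure ℂ)
    (f := LinearMap.mul ℝ ℂ c) (by rw [hd]; positivity)
  rw [hd, abs_of_nonneg (by positivity)] at h
  have h2 : ∫⁻ u, F u ∂(Measure.map (LinearMap.mul ℝ ℂ c) volume) = ∫⁻ w, F (c * w) :=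
    lintegral_map hF (by fun_prop)
  rw [← h2, h, lintegral_smul_measure, smul_eq_mul]

lemma lintegral_complex_radial (H : ℝ → ENNReal) (hH : Measurable H) :
    ∫⁻ z : ℂ, H ‖z‖ =
      ENNReal.ofReal (2 * Real.pi) * ∫⁻ r in Ioi (0 : ℝ), ENNReal.ofReal r * H r := by
  rw [← Complex.lintegral_comp_polarCoord_symm]
  have h1 : ∀ p ∈ polarCoord.target, ENNReal.ofReal p.1 • H ‖Complex.polarCoord.symm p‖ =
      (ENNReal.ofReal p.1 * H p.1) * (1 : ENNReal) := by
    intro p hp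
    have hp : 0 < p.1 := (Set.mem_prod.1 hp).1
    rw [Complex.norm_polarCoord_symm, abs_of_pos hp, smul_eq_mul, mul_one]
  rw [setLIntegral_congr_fun polarCoord.open_target.measurableSet h1, polarCoord_target,
    Measure.volume_eq_prod, ← Measure.prod_restrict,
    lintegral_prod_mul (f := fun r => ENNReal.ofReal r * H r) (g := fun _ => 1)
      (by fun_prop) (by fun_prop), lintegral_one, Measure.restrict_apply_univ, Real.volume_Ioo,
    mul_comm]
  congr 2
  ring

/-- The substitution `t = r² - k / (4 r²)`, an increasing bijection from `(0, ∞)` onto `ℝ`. -/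
lemma lintegral_hyperbolic {k : ℝ} (hk : 0 < k) (G : ℝ → ENNReal) :
    ∫⁻ r in Ioi (0 : ℝ), ENNReal.ofReal (2 * r + k / (2 * r ^ 3)) * G (r ^ 2 - k / (4 * r ^ 2)) =
      ∫⁻ t, G t := by
  have hder : ∀ r ∈ Ioi (0 : ℝ), HasDerivWithinAt (fun r : ℝ => r ^ 2 - k / (4 * r ^ 2))
      (2 * r + k / (2 * r ^ 3)) (Ioi 0) r := by
    intro r hr
    have hr : 0 < r := hr
    have h1 : HasDerivAt (fun r : ℝ => 4 * r ^ 2) (4 * (2 * r)) r := by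
      simpa using (hasDerivAt_pow 2 r).const_mul 4
    have h2 := (hasDerivAt_pow 2 r).sub ((hasDerivAt_const r k).div h1 (by positivity))
    refine (h2.congr_deriv ?_).hasDerivWithinAt
    field_simp
    simp; ring
  have hmono : StrictMonoOn (fun r : ℝ => r ^ 2 - k / (4 * r ^ 2)) (Ioi 0) := by
    intro r hr s hs hrs
    have hr : 0 < r := hr
    have : r ^ 2 < s ^ 2 := by gcongr
    have : k / (4 * s ^ 2) ≤ k / (4 * r ^ 2) := by gcongr
    simp only
    linarith
  have himg : (fun r : ℝ => r ^ 2 - k / (4 * r ^ 2)) '' Ioi 0 = univ := by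
    rw [eq_univ_iff_forall]
    intro t
    have hs : t ^ 2 < t ^ 2 + k := by linarith
    have h1 : |t| < √(t ^ 2 + k) := Real.lt_sqrt (abs_nonneg t) |>.2 (by rwa [sq_abs])
    have h2 : √(t ^ 2 + k) ^ 2 = t ^ 2 + k := Real.sq_sqrt (by positivity)
    have h3 : 0 < t + √(t ^ 2 + k) := by linarith [neg_abs_le t]
    -- the positive root of `r⁴ - t r² - k / 4`
    refine ⟨√((t + √(t ^ 2 + k)) / 2), Real.sqrt_pos.2 (by positivity), ?_⟩
    simp only
    rw [Real.sq_sqrt (by positivity)]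
    field_simp
    nlinarith
  have h := lintegral_image_eq_lintegral_abs_deriv_mul measurableSet_Ioi hder hmono.injOn G
  rw [himg, Measure.restrict_univ] at h
  rw [h]
  refine setLIntegral_congr_fun measurableSet_Ioi fun r hr => ?_
  have hr : 0 < r := hr
  rw [abs_of_pos (by positivity)]

/-- The Hopf map `ψ = (z, w) ↦ (2 z̄ w, |z|² - |w|²)` carries the measure `‖ψ‖² dψ` to `π / 4` times
Lebesgue measure on `ℝ³ = ℂ × ℝ`. For fixed `z` the linear substitution `u = 2 z̄ w` turns the second
coordinate into `|z|² - |u|² / (4 |z|²)` and `‖ψ‖²` into `|z|² + |u|² / (4 |z|²)`; for fixed `u` the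
remaining integral over `z` is radial, and the substitution `t = r² - |u|² / (4 r²)` makes it an
integral over `t` with a constant weight. -/
theorem lintegral_comp_bloch (g : EuclideanSpace ℝ (Fin 3) → ENNReal) (hg : Measurable g) :
    ∫⁻ ψ : Qubit, ENNReal.ofReal (‖ψ‖ ^ 2) * g (bloch ψ) =
      ENNReal.ofReal (Real.pi / 4) * ∫⁻ y, g y := by
  set G : ℂ × ℝ → ENNReal := fun p => g !₂[p.1.re, p.1.im, p.2] with hG
  have hGm : Measurable G := by
    refine hg.comp ((PiLp.continuous_toLp 2 _).measurable.comp (measurable_pi_lambda _ fun i => ?_))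
    fin_cases i <;> simp <;> fun_prop
  rw [lintegral_qubit _ (by have := continuous_bloch; fun_prop), lintegral_euclidean_three g hg,
    ← lintegral_const_mul' _ _ ENNReal.ofReal_ne_top]
  -- the integrand after the substitution `u = 2 z̄ w`, as a function of `u` and `r = |z|`
  set H : ℂ → ℝ → ENNReal := fun u r => ENNReal.ofReal (4 * r ^ 2)⁻¹ *
    (ENNReal.ofReal (r ^ 2 + ‖u‖ ^ 2 / (4 * r ^ 2)) * G (u, r ^ 2 - ‖u‖ ^ 2 / (4 * r ^ 2))) with hH
  have h1 : ∀ z : ℂ, z ≠ 0 → ∫⁻ w : ℂ, ENNReal.ofReal (‖(!₂[z, w] : Qubit)‖ ^ 2) *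
      g (bloch !₂[z, w]) = ∫⁻ u : ℂ, H u ‖z‖ := by
    intro z hz
    have hz' : 0 < ‖z‖ := norm_pos_iff.2 hz
    have := lintegral_comp_complex_mul (c := 2 * star z) (by simpa using hz)
      (fun u => ENNReal.ofReal (‖z‖ ^ 2 + ‖u‖ ^ 2 / (4 * ‖z‖ ^ 2)) *
        G (u, ‖z‖ ^ 2 - ‖u‖ ^ 2 / (4 * ‖z‖ ^ 2))) (by fun_prop)
    simp only [hH]
    rw [lintegral_const_mul' _ _ ENNReal.ofReal_ne_top]
    convert this using 1
    · refine lintegral_congr fun w => ?_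
      have e : ‖2 * star z * w‖ ^ 2 / (4 * ‖z‖ ^ 2) = ‖w‖ ^ 2 := by
        simp only [norm_mul, norm_star]
        field_simp
        norm_num
        ring
      rw [e, EuclideanSpace.norm_sq_eq, Fin.sum_univ_two]
      congr 2
      ext i
      fin_cases i <;> simp [bloch] <;> ring
    · congr 3
      simp only [norm_mul, norm_star]
      norm_num
      ring
  have hz0 : ∀ᵐ z : ℂ, z ≠ 0 := by simp [ae_iff, measure_singleton]
  rw [lintegral_congr_ae (hz0.mono h1), lintegral_lintegral_swap]
  · refine lintegral_congr_ae (hz0.mono fun u hu => ?_)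
    simp only
    have hu' : 0 < ‖u‖ := norm_pos_iff.2 hu
    have hHu : Measurable (H u) := by
      simp only [hH]
      fun_prop
    rw [lintegral_complex_radial (H u) hHu,
      ← lintegral_hyperbolic (k := ‖u‖ ^ 2) (by positivity)
      (fun t => G (u, t)), ← lintegral_const_mul' _ _ ENNReal.ofReal_ne_top,
      ← lintegral_const_mul' _ _ ENNReal.ofReal_ne_top]
    refine setLIntegral_congr_fun measurableSet_Ioi fun r hr => ?_
    have hr : 0 < r := hr
    simp only [hH, ← mul_assoc]
    congr 1
    rw [← ENNReal.ofReal_mul (by positivity), ← ENNReal.ofReal_mul (by positivity),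
      ← ENNReal.ofReal_mul (by positivity), ← ENNReal.ofReal_mul (by positivity)]
    congr 1
    field_simp
    ring
  · simp only [hH]
    fun_prop

/-! ### Polar coordinates in a normed space -/

section PolarCoordinates

variable {E : Type*} [NormedAddCommGroup E] [NormedSpace ℝ E] [FiniteDimensional ℝ E]
  [Nontrivial E] [MeasurableSpace E] [BorelSpace E] (μ : Measure E) [μ.IsAddHaarMeasure]

/-- The integral of the product of a function of the norm and a function of the direction splits. -/
lemma lintegral_norm_mul_toSphere (h : ℝ → ENNReal) (hh : Measurable h) (f : E → ENNReal)
    (hf : Measurable f) :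
    ∫⁻ x, h ‖x‖ * f (‖x‖⁻¹ • x) ∂μ =
      (∫⁻ r, h r.1 ∂Measure.volumeIoiPow (Module.finrank ℝ E - 1)) * ∫⁻ ω, f ω.1 ∂μ.toSphere := by
  have h0 : ∫⁻ x, h ‖x‖ * f (‖x‖⁻¹ • x) ∂μ =
      ∫⁻ x : ({(0)}ᶜ : Set E), h ‖x.1‖ * f (‖x.1‖⁻¹ • x.1) ∂(μ.comap (↑)) := by
    rw [lintegral_subtype_comap (measurableSet_singleton _).compl
      fun x => h ‖x‖ * f (‖x‖⁻¹ • x), restrict_compl_singleton]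
  have h1 := (μ.measurePreserving_homeomorphUnitSphereProd).lintegral_comp
    (f := fun p => f p.1.1 * h p.2.1) (by fun_prop)
  rw [h0, mul_comm, ← lintegral_prod_mul (by fun_prop) (by fun_prop), ← h1]
  simp [mul_comm]

lemma integral_polar {F : Type*} [NormedAddCommGroup F] [NormedSpace ℝ F] (f : E → F)
    (hf : Integrable f μ) :
    ∫ x, f x ∂μ = ∫ r in Ioi (0 : ℝ), r ^ (Module.finrank ℝ E - 1) •
      ∫ ω, f (r • ω.1) ∂μ.toSphere := by
  have hp := MeasurePreserving.symm (homeomorphUnitSphereProd E).toMeasurableEquiv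
    μ.measurePreserving_homeomorphUnitSphereProd
  have he := ((homeomorphUnitSphereProd E).symm.toMeasurableEquiv).measurableEmbedding
  have h0 : ∫ x, f x ∂μ = ∫ x : ({(0)}ᶜ : Set E), f x ∂(μ.comap (↑)) := by
    rw [integral_subtype_comap (measurableSet_singleton _).compl f,
      restrict_compl_singleton]
  have hi : Integrable (fun x : ({(0)}ᶜ : Set E) => f x) (μ.comap (↑)) := by
    exact (integrableOn_iff_comap_subtypeVal (measurableSet_singleton _).compl).1 hf.integrableOn
  rw [h0, ← hp.integral_comp he, integral_prod_symm]
  · simp only [Measure.volumeIoiPow, ENNReal.ofReal]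
    rw [integral_withDensity_eq_integral_smul
      (measurable_subtype_coe.pow_const _).real_toNNReal]
    refine (integral_subtype_comap measurableSet_Ioi
      fun r => Real.toNNReal (r ^ (Module.finrank ℝ E - 1)) •
        ∫ ω, f (r • ω.1) ∂μ.toSphere).trans ?_
    refine setIntegral_congr_fun measurableSet_Ioi fun r hr => ?_
    rw [NNReal.smul_def, Real.coe_toNNReal _ (pow_nonneg (le_of_lt hr) _)]
  · exact (hp.integrable_comp_emb he).2 hi

end PolarCoordinates

/-! ### The law of the Bloch vector -/

/-- The law on `ℝ³` of the Bloch vector of a Haar-distributed pure state. -/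
def blochLaw : Measure (EuclideanSpace ℝ (Fin 3)) :=
  haarState.map (fun ψ : Metric.sphere (0 : Qubit) 1 => bloch ψ)

lemma toSphere_univ_three :
    (volume : Measure (EuclideanSpace ℝ (Fin 3))).toSphere univ = ENNReal.ofReal (4 * Real.pi) := by
  rw [Measure.toSphere_apply_univ, EuclideanSpace.volume_ball_fin_three]
  rw [finrank_euclideanSpace_fin, ← ENNReal.ofReal_natCast, ← ENNReal.ofReal_pow (by norm_num),
    ← ENNReal.ofReal_mul (by norm_num), ← ENNReal.ofReal_mul (by norm_num)]
  congr 1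
  push_cast
  ring

instance isProbabilityMeasure_haarState : IsProbabilityMeasure haarState := by
  refine ⟨?_⟩
  rw [haarState, Measure.smul_apply, smul_eq_mul]
  exact ENNReal.inv_mul_cancel (Measure.measure_univ_ne_zero.2 (Measure.toSphere_ne_zero _))
    (measure_ne_top _ _)

/-- The Bloch vector of a Haar-distributed pure state is uniformly distributed on the unit sphere of
`ℝ³`. In polar coordinates on both sides, `lintegral_comp_bloch` says that the integrals of `f ∘ bloch`
over the sphere of `ℂ²` and of `f` over the sphere of `ℝ³` are proportional, with a factor independent
of `f`; the factor drops out on normalizing by `f = 1`. -/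
theorem blochLaw_eq : blochLaw = (ENNReal.ofReal (4 * Real.pi))⁻¹ •
    (volume : Measure (EuclideanSpace ℝ (Fin 3))).toSphere.map Subtype.val := by
  set σ₃ := (volume : Measure Qubit).toSphere with hσ₃
  set σ₂ := (volume : Measure (EuclideanSpace ℝ (Fin 3))).toSphere with hσ₂
  have hu : σ₂ univ = ENNReal.ofReal (4 * Real.pi) := toSphere_univ_three
  -- With this radial weight, `‖ψ‖² h(‖ψ‖²)` is almost everywhere the indicator of the unit
  -- ball of `ℂ²`, which shows that the factors below are finite and nonzero.
  set h : ℝ → ENNReal := (Iio (1 : ℝ)).indicator fun R => (ENNReal.ofReal R)⁻¹ with hh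
  have hhm : Measurable h := by
    refine Measurable.indicator ?_ measurableSet_Iio
    fun_prop
  obtain ⟨C₁, C₂, hball, hC⟩ : ∃ C₁ C₂ : ENNReal,
      C₁ * σ₃ univ = volume (Metric.ball (0 : Qubit) 1) ∧
      ∀ f : EuclideanSpace ℝ (Fin 3) → ENNReal, Measurable f →
        C₁ * ∫⁻ ω, f (bloch ω.1) ∂σ₃ = C₂ * ∫⁻ ω, f ω.1 ∂σ₂ := by
    refine ⟨∫⁻ r, ENNReal.ofReal (r.1 ^ 2) * h (r.1 ^ 2)
      ∂Measure.volumeIoiPow (Module.finrank ℝ Qubit - 1), ENNReal.ofReal (Real.pi / 4) *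
      ∫⁻ r, h r.1 ∂Measure.volumeIoiPow (Module.finrank ℝ (EuclideanSpace ℝ (Fin 3)) - 1),
      ?_, fun f hf => ?_⟩
    · have h := lintegral_norm_mul_toSphere (volume : Measure Qubit)
        (fun r => ENNReal.ofReal (r ^ 2) * h (r ^ 2)) (by fun_prop) (fun _ => 1) measurable_const
      simp only [mul_one, lintegral_one] at h
      rw [← h, ← lintegral_indicator_one Metric.isOpen_ball.measurableSet]
      have h0 : ∀ᵐ ψ : Qubit, ψ ≠ 0 := by simp [ae_iff, measure_singleton]
      refine lintegral_congr_ae (h0.mono fun ψ hψ => ?_)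
      have hψ' : 0 < ‖ψ‖ := norm_pos_iff.2 hψ
      by_cases hb : ‖ψ‖ < 1
      · have hb2 : ‖ψ‖ ^ 2 < 1 := by nlinarith
        simp only [hh, indicator, mem_Iio, hb2, if_true, mem_ball_zero_iff, hb, Pi.one_apply]
        exact ENNReal.mul_inv_cancel (by simpa using hψ) ENNReal.ofReal_ne_top
      · have hb2 : ¬ ‖ψ‖ ^ 2 < 1 := by nlinarith
        simp [hh, indicator, hb2, hb]
    rw [mul_assoc, ← lintegral_norm_mul_toSphere _ h hhm f hf,
      ← lintegral_comp_bloch _ (by fun_prop),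
      ← lintegral_norm_mul_toSphere volume (fun r => ENNReal.ofReal (r ^ 2) * h (r ^ 2))
        (by fun_prop) (fun ψ => f (bloch ψ)) (hf.comp continuous_bloch.measurable)]
    refine lintegral_congr fun ψ => ?_
    rw [norm_bloch, bloch_smul, inv_pow, mul_assoc]
  -- `f = 1`
  have h1 : C₁ * σ₃ univ = C₂ * σ₂ univ := by simpa using hC (fun _ => 1) measurable_const
  have hb0 : C₁ * σ₃ univ ≠ 0 := by
    rw [hball]; exact (Metric.measure_ball_pos volume 0 one_pos).ne'
  have hbt : C₁ * σ₃ univ ≠ ⊤ := by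
    rw [hball]; exact measure_ball_lt_top.ne
  have hσ₂0 : σ₂ univ ≠ 0 := fun h => by simp [h1, h] at hb0
  have hC₁0 : C₁ ≠ 0 := fun h => by simp [h] at hb0
  have hC₂0 : C₂ ≠ 0 := fun h => by simp [h1, h] at hb0
  have hC₁t : C₁ ≠ ⊤ := fun h => hbt (by
    rw [h, ENNReal.top_mul]; rintro h'; simp [h'] at hb0)
  have hC₂t : C₂ ≠ ⊤ := fun h => hbt (by
    rw [h1, h, ENNReal.top_mul hσ₂0])
  have key : ∀ x y : ENNReal, C₁ * x = C₂ * y → x = C₁⁻¹ * C₂ * y := fun x y hxy => by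
    rw [mul_assoc, ← hxy, ← mul_assoc, ENNReal.inv_mul_cancel hC₁0 hC₁t, one_mul]
  have hk0 : C₁⁻¹ * C₂ ≠ 0 := mul_ne_zero (ENNReal.inv_ne_zero.2 hC₁t) hC₂0
  have hkt : C₁⁻¹ * C₂ ≠ ⊤ := ENNReal.mul_ne_top (ENNReal.inv_ne_top.2 hC₁0) hC₂t
  have hbm : Measurable (fun ψ : Metric.sphere (0 : Qubit) 1 => bloch ψ) :=
    (continuous_bloch.comp continuous_subtype_val).measurable
  ext s hs
  have h2 := hC (s.indicator 1) (measurable_one.indicator hs)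
  have e1 : ∫⁻ ω, s.indicator (1 : EuclideanSpace ℝ (Fin 3) → ENNReal) (bloch ω.1) ∂σ₃ =
      σ₃ ((fun ψ : Metric.sphere (0 : Qubit) 1 => bloch ψ) ⁻¹' s) := by
    rw [← lintegral_indicator_one (hbm hs)]; rfl
  have e2 : ∫⁻ ω, s.indicator (1 : EuclideanSpace ℝ (Fin 3) → ENNReal) ω.1 ∂σ₂ =
      σ₂ (Subtype.val ⁻¹' s) := by
    rw [← lintegral_indicator_one (measurable_subtype_coe hs)]; rfl
  rw [e1, e2] at h2
  rw [blochLaw, Measure.map_apply hbm hs, haarState, Measure.smul_apply, Measure.smul_apply,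
    Measure.map_apply measurable_subtype_coe hs, ← hu, smul_eq_mul, smul_eq_mul, ← hσ₃,
    key _ _ h2, key _ _ h1, ENNReal.mul_inv (.inl hk0) (.inl hkt), mul_mul_mul_comm,
    ENNReal.inv_mul_cancel hk0 hkt, one_mul]

section Pointwise

open scoped Pointwise

lemma blochLaw_apply {s : Set (EuclideanSpace ℝ (Fin 3))} (hs : MeasurableSet s) :
    blochLaw s = (ENNReal.ofReal (4 * Real.pi))⁻¹ *
      (3 * volume (Ioo (0 : ℝ) 1 • (Metric.sphere 0 1 ∩ s))) := by
  rw [blochLaw_eq, Measure.smul_apply, Measure.map_apply measurable_subtype_coe hs,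
    Measure.toSphere_apply' _ (measurable_subtype_coe hs), Subtype.image_preimage_coe,
    smul_eq_mul, finrank_euclideanSpace_fin]
  norm_num

/-- Orthogonal states have opposite Bloch vectors; the law is symmetric under this reflection. -/
lemma map_neg_blochLaw : blochLaw.map (fun y => -y) = blochLaw := by
  ext s hs
  rw [Measure.map_apply measurable_neg hs, blochLaw_apply (measurable_neg hs), blochLaw_apply hs]
  congr 2
  rw [← Measure.measure_neg]
  congr 1
  ext y
  simp only [Set.mem_neg, Set.mem_smul, mem_inter_iff, mem_sphere_zero_iff_norm]
  constructor
  · rintro ⟨r, hr, x, hx, h⟩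
    exact ⟨r, hr, -x, ⟨by simpa using hx.1, hx.2⟩, by rw [smul_neg, h, neg_neg]⟩
  · rintro ⟨r, hr, x, hx, h⟩
    exact ⟨r, hr, -x, ⟨by simpa using hx.1, by simpa using hx.2⟩, by rw [smul_neg, h]⟩

lemma blochLaw_submodule (V : Submodule ℝ (EuclideanSpace ℝ (Fin 3))) (hV : V ≠ ⊤) :
    blochLaw V = 0 := by
  rw [blochLaw_apply V.closed_of_finiteDimensional.measurableSet]
  have : volume (Ioo (0 : ℝ) 1 •
      (Metric.sphere 0 1 ∩ (V : Set (EuclideanSpace ℝ (Fin 3))))) = 0 := by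
    refine measure_mono_null ?_ (Measure.addHaar_submodule volume V hV)
    rintro _ ⟨r, -, y, hy, rfl⟩
    exact V.smul_mem r hy.2
  rw [this]; simp

end Pointwise

lemma ae_norm_blochLaw : ∀ᵐ y ∂blochLaw, ‖y‖ = 1 := by
  rw [blochLaw_eq]
  refine Measure.ae_smul_measure ?_ _
  rw [ae_map_iff measurable_subtype_coe.aemeasurable
    (measurableSet_eq_fun (by fun_prop) (by fun_prop))]
  exact ae_of_all _ fun ω => by simp

/-! ### Expectations and uncertainties as functions of the Bloch vector -/

/-- The three expectation values, as a function of the Bloch vector `n`. -/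
def meanVec (a₀ b₀ c₀ : ℝ) (a b c n : EuclideanSpace ℝ (Fin 3)) : ℝ × ℝ × ℝ :=
  (a₀ + inner ℝ a n, b₀ + inner ℝ b n, c₀ + inner ℝ c n)

/-- The three uncertainties, as a function of the Bloch vector `n`. -/
def spreadVec (a b c n : EuclideanSpace ℝ (Fin 3)) : ℝ × ℝ × ℝ :=
  (√(‖a‖ ^ 2 - inner ℝ a n ^ 2), √(‖b‖ ^ 2 - inner ℝ b n ^ 2), √(‖c‖ ^ 2 - inner ℝ c n ^ 2))

lemma measurable_meanVec (a₀ b₀ c₀ : ℝ) (a b c : EuclideanSpace ℝ (Fin 3)) :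
    Measurable (meanVec a₀ b₀ c₀ a b c) := by
  unfold meanVec; fun_prop

lemma measurable_spreadVec (a b c : EuclideanSpace ℝ (Fin 3)) :
    Measurable (spreadVec a b c) := by
  unfold spreadVec; fun_prop

lemma measurable_bloch_sphere : Measurable (fun ψ : Metric.sphere (0 : Qubit) 1 => bloch ψ) :=
  (continuous_bloch.comp continuous_subtype_val).measurable

lemma meanDensity_qubitObs (a₀ b₀ c₀ : ℝ) (a b c : EuclideanSpace ℝ (Fin 3)) :
    meanDensity (qubitObs a₀ a) (qubitObs b₀ b) (qubitObs c₀ c) =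
      blochLaw.map (meanVec a₀ b₀ c₀ a b c) := by
  rw [blochLaw, Measure.map_map (measurable_meanVec ..) measurable_bloch_sphere,
    meanDensity, jointDensity]
  congr 1
  ext1 ψ
  have h : ‖(ψ : Qubit)‖ = 1 := norm_eq_of_mem_sphere ψ
  simp [expectation_qubitObs, meanVec, h]

lemma uncertaintyDensity_qubitObs (a₀ b₀ c₀ : ℝ) (a b c : EuclideanSpace ℝ (Fin 3)) :
    uncertaintyDensity (qubitObs a₀ a) (qubitObs b₀ b) (qubitObs c₀ c) =
      blochLaw.map (spreadVec a b c) := by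
  rw [blochLaw, Measure.map_map (measurable_spreadVec ..) measurable_bloch_sphere,
    uncertaintyDensity, jointDensity]
  congr 1
  ext1 ψ
  have h : ‖(ψ : Qubit)‖ = 1 := norm_eq_of_mem_sphere ψ
  simp [uncertainty_qubitObs, spreadVec, h]

/-! ### The branches of the inverse of `t ↦ √(m² - t²)` -/

lemma units_sq (ε : ℤˣ) : (((ε : ℤ) : ℝ)) ^ 2 = 1 := by
  rcases Int.units_eq_one_or ε with rfl | rfl <;> simp

/-- `branch m₀ m ε` inverts `m₀ + t ↦ √(m² - t²)` on the half `0 < ε t` of the interval `|t| < m`. -/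
lemma branch_eq_iff {m₀ m x t : ℝ} (hm : 0 < m) (hx : x ∈ Ioo 0 m) (ε : ℤˣ) :
    branch m₀ m ε x = m₀ + t ↔ √(m ^ 2 - t ^ 2) = x ∧ 0 < ((ε : ℤ) : ℝ) * t := by
  obtain ⟨h0, h1⟩ := hx
  have hs : 0 < m ^ 2 - x ^ 2 := by nlinarith
  have hss := Real.sq_sqrt hs.le
  have hsp := Real.sqrt_pos.2 hs
  have he := units_sq ε
  rw [branch, add_right_inj]
  constructor
  · rintro rfl
    rw [mul_pow, he, one_mul, hss, ← mul_assoc, ← pow_two, he]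
    refine ⟨?_, by linarith⟩
    rw [sub_sub_cancel, Real.sqrt_sq h0.le]
  · rintro ⟨rfl, ht⟩
    have h2 : 0 < m ^ 2 - t ^ 2 := Real.sqrt_pos.1 h0
    rw [Real.sq_sqrt h2.le, sub_sub_cancel]
    rw [show t ^ 2 = (((ε : ℤ) : ℝ) * t) ^ 2 by rw [mul_pow, he, one_mul], Real.sqrt_sq ht.le,
      ← mul_assoc, ← pow_two, he, one_mul]

lemma hasDerivAt_branch {m₀ m x : ℝ} (hx : x ∈ Ioo 0 m) (ε : ℤˣ) :
    HasDerivAt (branch m₀ m ε) (-(((ε : ℤ) : ℝ) * (x / √(m ^ 2 - x ^ 2)))) x := by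
  have hs : 0 < m ^ 2 - x ^ 2 := by nlinarith [hx.1, hx.2]
  have h1 : HasDerivAt (fun x => m ^ 2 - x ^ 2) (-(2 * x)) x := by
    simpa using (hasDerivAt_pow 2 x).const_sub (m ^ 2)
  refine (((h1.sqrt hs.ne').const_mul (((ε : ℤ) : ℝ))).const_add m₀).congr_deriv ?_
  field_simp

lemma det_fderiv_prodMap {f g h : ℝ → ℝ} {f' g' h' : ℝ} {p : ℝ × ℝ × ℝ} (hf : HasDerivAt f f' p.1)
    (hg : HasDerivAt g g' p.2.1) (hh : HasDerivAt h h' p.2.2) :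
    (fderiv ℝ (fun p : ℝ × ℝ × ℝ => (f p.1, g p.2.1, h p.2.2)) p).det = f' * (g' * h') := by
  have h1 := hf.hasFDerivAt.prodMap p (hg.hasFDerivAt.prodMap p.2 hh.hasFDerivAt)
  have h2 : fderiv ℝ (fun p : ℝ × ℝ × ℝ => (f p.1, g p.2.1, h p.2.2)) p = _ := h1.fderiv
  rw [h2, ContinuousLinearMap.det, ContinuousLinearMap.coe_prodMap, LinearMap.det_prodMap,
    ContinuousLinearMap.coe_prodMap, LinearMap.det_prodMap]
  simp

lemma continuous_branch (m₀ m : ℝ) (ε : ℤˣ) : Continuous (branch m₀ m ε) := by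
  unfold branch; fun_prop

lemma injOn_branch {m₀ m : ℝ} (hm : 0 < m) (ε : ℤˣ) : InjOn (branch m₀ m ε) (Ioo 0 m) := by
  intro x hx y hy hxy
  have h1 := ((branch_eq_iff (m₀ := m₀) (t := branch m₀ m ε x - m₀) hm hx ε).1 (by ring)).1
  have h2 := ((branch_eq_iff (m₀ := m₀) (t := branch m₀ m ε x - m₀) hm hy ε).1
    (by rw [hxy]; ring)).1
  rw [← h1, h2]

/-! ### The joint density of the uncertainties -/

/-- The open box in which the uncertainties almost surely lie. -/
abbrev spreadBox (a b c : EuclideanSpace ℝ (Fin 3)) : Set (ℝ × ℝ × ℝ) :=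
  Ioo 0 ‖a‖ ×ˢ Ioo 0 ‖b‖ ×ˢ Ioo 0 ‖c‖

lemma measurableSet_spreadBox (a b c : EuclideanSpace ℝ (Fin 3)) :
    MeasurableSet (spreadBox a b c) :=
  measurableSet_Ioo.prod (measurableSet_Ioo.prod measurableSet_Ioo)

/-- The inverse branch, with signs `i, j, k`, of the map from expectation values to uncertainties. -/
abbrev branchMap (a₀ b₀ c₀ : ℝ) (a b c : EuclideanSpace ℝ (Fin 3)) (i j k : ℤˣ)
    (p : ℝ × ℝ × ℝ) : ℝ × ℝ × ℝ :=
  (branch a₀ ‖a‖ i p.1, branch b₀ ‖b‖ j p.2.1, branch c₀ ‖c‖ k p.2.2)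

/-- The factor `2xyz / √((a² - x²)(b² - y²)(c² - z²))`. -/
abbrev spreadWeight (a b c : EuclideanSpace ℝ (Fin 3)) (p : ℝ × ℝ × ℝ) : ℝ :=
  2 * p.1 * p.2.1 * p.2.2 /
    √((‖a‖ ^ 2 - p.1 ^ 2) * (‖b‖ ^ 2 - p.2.1 ^ 2) * (‖c‖ ^ 2 - p.2.2 ^ 2))

/-- The factor is twice the Jacobian of each inverse branch, so it cancels the Jacobian in the pullback
up to the factor `2`. -/
lemma jacobian_mul_spreadWeight (a₀ b₀ c₀ : ℝ) {a b c : EuclideanSpace ℝ (Fin 3)} (i j k : ℤˣ)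
    {p : ℝ × ℝ × ℝ} (hp : p ∈ spreadBox a b c) :
    |(fderiv ℝ (branchMap a₀ b₀ c₀ a b c i j k) p).det|⁻¹ * spreadWeight a b c p = 2 := by
  obtain ⟨h1, h2, h3⟩ := hp
  rw [det_fderiv_prodMap (hasDerivAt_branch h1 i) (hasDerivAt_branch h2 j) (hasDerivAt_branch h3 k)]
  have hs1 : 0 < ‖a‖ ^ 2 - p.1 ^ 2 := by nlinarith [h1.1, h1.2]
  have hs2 : 0 < ‖b‖ ^ 2 - p.2.1 ^ 2 := by nlinarith [h2.1, h2.2]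
  have hs3 : 0 < ‖c‖ ^ 2 - p.2.2 ^ 2 := by nlinarith [h3.1, h3.2]
  have e : ∀ ε : ℤˣ, |((ε : ℤ) : ℝ)| = 1 := fun ε => by
    rcases Int.units_eq_one_or ε with rfl | rfl <;> simp
  have p1 := h1.1
  have p2 := h2.1
  have p3 := h3.1
  have q1 := Real.sqrt_pos.2 hs1
  have q2 := Real.sqrt_pos.2 hs2
  have q3 := Real.sqrt_pos.2 hs3
  rw [spreadWeight, Real.sqrt_mul (by positivity), Real.sqrt_mul hs1.le]
  simp only [abs_mul, abs_neg, e, one_mul, abs_div, abs_of_pos p1, abs_of_pos p2, abs_of_pos p3,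
    abs_of_pos q1, abs_of_pos q2, abs_of_pos q3]
  field_simp

lemma measurableEmbedding_branchMap (a₀ b₀ c₀ : ℝ) {a b c : EuclideanSpace ℝ (Fin 3)}
    (ha : a ≠ 0) (hb : b ≠ 0) (hc : c ≠ 0) (i j k : ℤˣ) :
    MeasurableEmbedding (fun p : spreadBox a b c => branchMap a₀ b₀ c₀ a b c i j k p) := by
  have : PolishSpace (spreadBox a b c) :=
    (isOpen_Ioo.prod (isOpen_Ioo.prod isOpen_Ioo)).polishSpace
  refine Continuous.measurableEmbedding ?_ ?_
  · have h1 := continuous_branch a₀ ‖a‖ i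
    have h2 := continuous_branch b₀ ‖b‖ j
    have h3 := continuous_branch c₀ ‖c‖ k
    fun_prop
  · rintro ⟨p, hp⟩ ⟨q, hq⟩ h
    simp only [Prod.mk.injEq] at h
    ext1
    exact Prod.ext (injOn_branch (norm_pos_iff.2 ha) i hp.1 hq.1 h.1)
      (Prod.ext (injOn_branch (norm_pos_iff.2 hb) j hp.2.1 hq.2.1 h.2.1)
        (injOn_branch (norm_pos_iff.2 hc) k hp.2.2 hq.2.2 h.2.2))

lemma withDensity_substDensity_apply (a₀ b₀ c₀ : ℝ) {a b c : EuclideanSpace ℝ (Fin 3)}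
    (ha : a ≠ 0) (hb : b ≠ 0) (hc : c ≠ 0) (i j k : ℤˣ) (u : Measure (ℝ × ℝ × ℝ))
    {s : Set (ℝ × ℝ × ℝ)} (hs : MeasurableSet s) :
    (substDensity u (spreadBox a b c) (branchMap a₀ b₀ c₀ a b c i j k)).withDensity
      (fun p => ENNReal.ofReal (spreadWeight a b c p)) s =
    2 * u (branchMap a₀ b₀ c₀ a b c i j k '' (s ∩ spreadBox a b c)) := by
  have hU := measurableSet_spreadBox a b c
  have hw : Measurable (spreadWeight a b c) := by unfold spreadWeight; fun_prop
  have hd : Measurable (fun p => |(fderiv ℝ (branchMap a₀ b₀ c₀ a b c i j k) p).det|⁻¹) := by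
    have := measurable_fderiv ℝ (branchMap a₀ b₀ c₀ a b c i j k)
    have := ContinuousLinearMap.continuous_det.measurable.comp this
    fun_prop
  rw [substDensity, ← withDensity_mul _ (by fun_prop) (by fun_prop), withDensity_apply _ hs,
    setLIntegral_map hs (by fun_prop) measurable_subtype_coe]
  have h2 : ∀ p : spreadBox a b c,
      ((fun p => ENNReal.ofReal |(fderiv ℝ (branchMap a₀ b₀ c₀ a b c i j k) p).det|⁻¹) *
        (fun p => ENNReal.ofReal (spreadWeight a b c p))) p = 2 := by
    intro p
    rw [Pi.mul_apply, ← ENNReal.ofReal_mul (by positivity),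
      jacobian_mul_spreadWeight _ _ _ _ _ _ p.2]
    simp
  simp only [h2]
  rw [setLIntegral_const, (measurableEmbedding_branchMap a₀ b₀ c₀ ha hb hc i j k).comap_apply]
  congr 2
  ext q
  simp only [mem_image, mem_preimage, mem_inter_iff, Subtype.exists]
  grind

lemma sum_units_measure_pos {α : Type*} [MeasurableSpace α] (P : Measure α) {f : α → ℝ}
    (hf : Measurable f) {D : Set α} (h : ∀ x ∈ D, f x ≠ 0) :
    ∑ ε : ℤˣ, P (D ∩ {x | 0 < ((ε : ℤ) : ℝ) * f x}) = P D := by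
  have hm : MeasurableSet {x | 0 < f x} := measurableSet_lt measurable_const hf
  rw [← measure_inter_add_sdiff D hm, Fintype.sum_eq_add (1 : ℤˣ) (-1) (by decide)
    (fun x hx => by rcases Int.units_eq_one_or x with rfl | rfl <;> simp at hx)]
  congr 1
  · simp
  · congr 1
    ext x
    simp only [mem_inter_iff, mem_ofPred_eq, Set.mem_sdiff]
    refine and_congr_right fun hx => ?_
    have := h x hx
    simp
    grind

lemma meanVec_mem_image_iff {a₀ b₀ c₀ : ℝ} {a b c : EuclideanSpace ℝ (Fin 3)}
    (ha : a ≠ 0) (hb : b ≠ 0) (hc : c ≠ 0) (i j k : ℤˣ) (s : Set (ℝ × ℝ × ℝ))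
    (n : EuclideanSpace ℝ (Fin 3)) :
    meanVec a₀ b₀ c₀ a b c n ∈ branchMap a₀ b₀ c₀ a b c i j k '' (s ∩ spreadBox a b c) ↔
      spreadVec a b c n ∈ s ∩ spreadBox a b c ∧ 0 < ((i : ℤ) : ℝ) * inner ℝ a n ∧
        0 < ((j : ℤ) : ℝ) * inner ℝ b n ∧ 0 < ((k : ℤ) : ℝ) * inner ℝ c n := by
  have key : ∀ p ∈ spreadBox a b c, branchMap a₀ b₀ c₀ a b c i j k p = meanVec a₀ b₀ c₀ a b c n ↔
      spreadVec a b c n = p ∧ 0 < ((i : ℤ) : ℝ) * inner ℝ a n ∧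
        0 < ((j : ℤ) : ℝ) * inner ℝ b n ∧ 0 < ((k : ℤ) : ℝ) * inner ℝ c n := by
    intro p hp
    simp only [meanVec, branch_eq_iff (norm_pos_iff.2 ha) hp.1,
      branch_eq_iff (norm_pos_iff.2 hb) hp.2.1, branch_eq_iff (norm_pos_iff.2 hc) hp.2.2,
      spreadVec, Prod.ext_iff]
    tauto
  constructor
  · rintro ⟨p, hp, h⟩
    obtain ⟨rfl, h'⟩ := (key p hp.2).1 h
    exact ⟨hp, h'⟩
  · rintro ⟨hp, h⟩
    exact ⟨_, hp, (key _ hp.2).2 ⟨rfl, h⟩⟩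

/-- The uncertainty avoids its extreme values almost surely: it is `|a|` only if the Bloch vector is
orthogonal to `a`, and `0` only if the Bloch vector is parallel to `a`. -/
lemma ae_spread_mem_Ioo {a : EuclideanSpace ℝ (Fin 3)} (ha : a ≠ 0) :
    ∀ᵐ n ∂blochLaw, √(‖a‖ ^ 2 - inner ℝ a n ^ 2) ∈ Ioo 0 ‖a‖ := by
  have ha' := norm_pos_iff.2 ha
  have h1 : ∀ᵐ n ∂blochLaw, n ∉ ((ℝ ∙ a)ᗮ : Submodule ℝ (EuclideanSpace ℝ (Fin 3))) := by
    refine measure_eq_zero_iff_ae_notMem.1 (blochLaw_submodule _ ?_)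
    rw [Ne, Submodule.orthogonal_eq_top_iff]
    simpa using ha
  have h2 : ∀ᵐ n ∂blochLaw, n ∉ (ℝ ∙ a : Submodule ℝ (EuclideanSpace ℝ (Fin 3))) := by
    refine measure_eq_zero_iff_ae_notMem.1 (blochLaw_submodule _ ?_)
    intro h
    have h3 := finrank_span_singleton (K := ℝ) ha
    rw [h, finrank_top, finrank_euclideanSpace_fin] at h3
    omega
  filter_upwards [h1, h2, ae_norm_blochLaw] with n h1 h2 hn
  rw [Submodule.mem_orthogonal_singleton_iff_inner_right] at h1
  have h3 : |inner ℝ a n| < ‖a‖ := by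
    refine lt_of_le_of_ne (by simpa [hn] using abs_real_inner_le_norm a n) fun h => h2 ?_
    have h4 := (norm_inner_eq_norm_iff (𝕜 := ℝ) (y := n) ha (by rintro rfl; simp at hn)).1
      (by rw [Real.norm_eq_abs, h, hn, mul_one])
    obtain ⟨r, -, rfl⟩ := h4
    exact Submodule.smul_mem _ _ (Submodule.mem_span_singleton_self a)
  refine ⟨Real.sqrt_pos.2 ?_, ?_⟩
  · have := sq_lt_sq' (neg_lt_of_abs_lt h3) (lt_of_abs_lt h3)
    linarith
  · rw [Real.sqrt_lt' ha']
    have : 0 < inner ℝ a n ^ 2 := by positivity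
    linarith

/-- Each term on the right is twice the probability that the uncertainties lie in the given set and the
centred expectation values have signs `+, j, k`. The sum over `j` and `k` leaves the condition that the
first sign is `+`, which by the reflection `n ↦ -n` has the same probability as its opposite. -/
theorem uncertaintyDensity_formula (a₀ b₀ c₀ : ℝ) {a b c : EuclideanSpace ℝ (Fin 3)}
    (ha : a ≠ 0) (hb : b ≠ 0) (hc : c ≠ 0) :
    uncertaintyDensity (qubitObs a₀ a) (qubitObs b₀ b) (qubitObs c₀ c) =
      (∑ j : ℤˣ, ∑ k : ℤˣ,
        substDensity (meanDensity (qubitObs a₀ a) (qubitObs b₀ b) (qubitObs c₀ c))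
          (spreadBox a b c) (branchMap a₀ b₀ c₀ a b c 1 j k)).withDensity
        (fun p => ENNReal.ofReal (spreadWeight a b c p)) := by
  have hU := measurableSet_spreadBox a b c
  have hM := measurable_meanVec a₀ b₀ c₀ a b c
  have hS := measurable_spreadVec a b c
  ext s hs
  have hsum : ∀ (ν : ℤˣ → ℤˣ → Measure (ℝ × ℝ × ℝ)) (w : ℝ × ℝ × ℝ → ENNReal),
      (∑ j, ∑ k, ν j k).withDensity w s = ∑ j, ∑ k, (ν j k).withDensity w s := by
    intro ν w
    simp only [withDensity_apply _ hs, ← lintegral_indicator hs, lintegral_finsetSum_measure]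
  rw [hsum]
  simp only [withDensity_substDensity_apply a₀ b₀ c₀ ha hb hc _ _ _ _ hs]
  set D : Set (EuclideanSpace ℝ (Fin 3)) := spreadVec a b c ⁻¹' (s ∩ spreadBox a b c) with hD
  have hDm : MeasurableSet D := hS (hs.inter hU)
  have himg : ∀ j k, meanDensity (qubitObs a₀ a) (qubitObs b₀ b) (qubitObs c₀ c)
      (branchMap a₀ b₀ c₀ a b c 1 j k '' (s ∩ spreadBox a b c)) =
      blochLaw (((D ∩ {n | 0 < inner ℝ a n}) ∩ {n | 0 < ((j : ℤ) : ℝ) * inner ℝ b n}) ∩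
        {n | 0 < ((k : ℤ) : ℝ) * inner ℝ c n}) := by
    intro j k
    have hm : MeasurableSet (branchMap a₀ b₀ c₀ a b c 1 j k '' (s ∩ spreadBox a b c)) := by
      have h := (measurableEmbedding_branchMap a₀ b₀ c₀ ha hb hc 1 j k).measurableSet_image.2
        (measurable_subtype_coe hs)
      convert h using 1
      ext q
      simp only [mem_image, mem_preimage, mem_inter_iff, Subtype.exists]
      grind
    rw [meanDensity_qubitObs, Measure.map_apply hM hm]
    congr 1
    ext n
    rw [mem_preimage, meanVec_mem_image_iff ha hb hc]
    simp [hD, and_assoc]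
  have hne : ∀ n ∈ D, inner ℝ a n ≠ 0 ∧ inner ℝ b n ≠ 0 ∧ inner ℝ c n ≠ 0 := by
    rintro n ⟨-, h1, h2, h3⟩
    refine ⟨fun h => ?_, fun h => ?_, fun h => ?_⟩
    · simp [spreadVec, h] at h1
    · simp [spreadVec, h] at h2
    · simp [spreadVec, h] at h3
  simp only [himg, ← Finset.mul_sum]
  simp only [sum_units_measure_pos blochLaw (f := fun n => inner ℝ c n) (by fun_prop)
    (fun n (hn : n ∈ (D ∩ {n | 0 < inner ℝ a n}) ∩ {n | 0 < _ * inner ℝ b n}) =>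
      (hne n hn.1.1).2.2)]
  rw [sum_units_measure_pos blochLaw (f := fun n => inner ℝ b n) (by fun_prop)
    (fun n hn => (hne n hn.1).2.1)]
  have hsym : blochLaw (D ∩ {n | 0 < ((-1 : ℤˣ) : ℤ) * inner ℝ a n}) =
      blochLaw (D ∩ {n | 0 < inner ℝ a n}) := by
    have hm : MeasurableSet (D ∩ {n | 0 < inner ℝ a n}) :=
      hDm.inter (measurableSet_lt measurable_const (by fun_prop))
    conv_rhs => rw [← map_neg_blochLaw, Measure.map_apply measurable_neg hm]
    congr 1
    ext n
    simp [hD, spreadVec]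
  have hsplit := sum_units_measure_pos blochLaw (f := fun n => inner ℝ a n) (by fun_prop)
    (fun n hn => (hne n hn).1)
  rw [Fintype.sum_eq_add (1 : ℤˣ) (-1) (by decide)
    (fun x hx => by rcases Int.units_eq_one_or x with rfl | rfl <;> simp at hx), hsym] at hsplit
  simp only [Units.val_one, Int.cast_one, one_mul] at hsplit
  rw [two_mul, hsplit, uncertaintyDensity_qubitObs, Measure.map_apply hS hs]
  refine measure_congr ?_
  filter_upwards [ae_spread_mem_Ioo ha, ae_spread_mem_Ioo hb, ae_spread_mem_Ioo hc] with n h1 h2 h3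
  have : spreadVec a b c n ∈ spreadBox a b c := ⟨h1, h2, h3⟩
  exact propext ⟨fun h => ⟨h, this⟩, fun h => h.1⟩

/-! ### Linear change of variables and the Gram matrix -/

/-- The matrix with rows `a`, `b`, `c`. -/
def rowMatrix (a b c : EuclideanSpace ℝ (Fin 3)) : Matrix (Fin 3) (Fin 3) ℝ :=
  Matrix.of ![a, b, c]

lemma rowMatrix_mulVec (a b c n : EuclideanSpace ℝ (Fin 3)) :
    rowMatrix a b c *ᵥ n = ![inner ℝ a n, inner ℝ b n, inner ℝ c n] := by
  ext i
  fin_cases i <;> simp [rowMatrix, mulVec, dotProduct, PiLp.inner_apply, mul_comm]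

lemma gramABC_eq (a b c : EuclideanSpace ℝ (Fin 3)) :
    gramABC a b c = rowMatrix a b c * (rowMatrix a b c)ᵀ := by
  ext i j
  fin_cases i <;> fin_cases j <;>
    simp [gramABC, rowMatrix, Matrix.mul_apply, PiLp.inner_apply, mul_comm,
      -inner_self_eq_norm_sq_to_K]

lemma sqrt_det_gramABC (a b c : EuclideanSpace ℝ (Fin 3)) :
    √(gramABC a b c).det = |(rowMatrix a b c).det| := by
  rw [gramABC_eq, det_mul, det_transpose, ← pow_two, Real.sqrt_sq_eq_abs]

lemma det_rowMatrix_ne_zero {a b c : EuclideanSpace ℝ (Fin 3)}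
    (h : LinearIndependent ℝ ![a, b, c]) : (rowMatrix a b c).det ≠ 0 := by
  have h1 : LinearIndependent ℝ (rowMatrix a b c).row := by
    have h2 := h.map' (WithLp.linearEquiv 2 ℝ (Fin 3 → ℝ)).toLinearMap (LinearEquiv.ker _)
    have e : (rowMatrix a b c).row =
        (WithLp.linearEquiv 2 ℝ (Fin 3 → ℝ)).toLinearMap ∘ ![a, b, c] := by
      ext i j
      fin_cases i <;> rfl
    rw [e]
    exact h2
  rw [Matrix.linearIndependent_rows_iff_isUnit] at h1
  exact ((Matrix.isUnit_iff_isUnit_det _).1 h1).ne_zero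

/-- `ω` is the norm of the vector `n` that has the given expectation values: with `M` the matrix of rows
`a, b, c`, one has `T = M Mᵀ`, so `(M n)ᵀ T⁻¹ (M n) = |n|²`. -/
lemma omegaABC_meanVec (a₀ b₀ c₀ : ℝ) {a b c : EuclideanSpace ℝ (Fin 3)}
    (h : (rowMatrix a b c).det ≠ 0) (n : EuclideanSpace ℝ (Fin 3)) :
    omegaABC a₀ b₀ c₀ a b c (meanVec a₀ b₀ c₀ a b c n) = ‖n‖ := by
  have hv : ![(meanVec a₀ b₀ c₀ a b c n).1 - a₀, (meanVec a₀ b₀ c₀ a b c n).2.1 - b₀,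
      (meanVec a₀ b₀ c₀ a b c n).2.2 - c₀] = rowMatrix a b c *ᵥ n := by
    rw [rowMatrix_mulVec]; simp [meanVec]
  have hu : IsUnit (rowMatrix a b c).det := isUnit_iff_ne_zero.2 h
  rw [omegaABC, hv, gramABC_eq, Matrix.mul_inv_rev, mulVec_mulVec, Matrix.mul_assoc,
    Matrix.nonsing_inv_mul _ hu, Matrix.mul_one, dotProduct_mulVec, ← vecMul_transpose,
    vecMul_vecMul, Matrix.mul_nonsing_inv _ (by rwa [det_transpose]), vecMul_one,
    EuclideanSpace.norm_eq]
  simp [dotProduct, pow_two]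

lemma map_meanVec_volume (a₀ b₀ c₀ : ℝ) {a b c : EuclideanSpace ℝ (Fin 3)}
    (h : (rowMatrix a b c).det ≠ 0) :
    (volume : Measure (EuclideanSpace ℝ (Fin 3))).map (meanVec a₀ b₀ c₀ a b c) =
      ENNReal.ofReal |(rowMatrix a b c).det|⁻¹ • volume := by
  set N := Matrix.toEuclideanLin (rowMatrix a b c) with hN
  have hNd : LinearMap.det N = (rowMatrix a b c).det := by
    rw [hN, Matrix.toEuclideanLin_eq_toLin_orthonormal, LinearMap.det_toLin]
  have hNm : Measurable N := N.continuous_of_finiteDimensional.measurable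
  have h1 := Measure.map_linearMap_addHaar_eq_smul_addHaar
    (volume : Measure (EuclideanSpace ℝ (Fin 3))) (f := N) (by rwa [hNd])
  have : (volume : Measure (ℝ × ℝ × ℝ)).IsAddLeftInvariant :=
    Measure.prod.instIsAddLeftInvariant (μ := (volume : Measure ℝ))
      (ν := (volume : Measure (ℝ × ℝ)))
  have h2 := (measurePreserving_add_left (volume : Measure (ℝ × ℝ × ℝ))
    ((a₀, b₀, c₀) : ℝ × ℝ × ℝ)).comp volume_preserving_coord3
  have h3 : meanVec a₀ b₀ c₀ a b c = ((fun p => (a₀, b₀, c₀) + p) ∘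
      fun x : EuclideanSpace ℝ (Fin 3) => (x 0, x 1, x 2)) ∘ N := by
    ext1 n
    have := rowMatrix_mulVec a b c n
    simp [meanVec, hN, Matrix.toLpLin_apply, this]
  rw [h3, ← Measure.map_map h2.measurable hNm, h1, Measure.map_smul, h2.map_eq, hNd, abs_inv]

/-! ### The surface measure as a limit of thin shells -/

/-- The limit of normalized thin shells around the unit sphere is the surface measure: in polar
coordinates the shell integral is that of a continuous function of `r` over `(1 - ε, 1 + ε)`. -/
lemma tendsto_integral_shell {F : Type*} [NormedAddCommGroup F] [NormedSpace ℝ F] [CompleteSpace F]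
    {E : Type*} [NormedAddCommGroup E] [NormedSpace ℝ E]
    [FiniteDimensional ℝ E] [Nontrivial E] [MeasurableSpace E] [BorelSpace E] (μ : Measure E)
    [μ.IsAddHaarMeasure] {f : E → F} (hf : Continuous f) :
    Tendsto (fun ε : ℝ => (2 * ε)⁻¹ • ∫ x in {x | |1 - ‖x‖| < ε}, f x ∂μ) (𝓝[>] 0)
      (𝓝 (∫ ω, f ω.1 ∂μ.toSphere)) := by
  set G : ℝ → F := fun r => r ^ (Module.finrank ℝ E - 1) • ∫ ω, f (r • ω.1) ∂μ.toSphere with hG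
  have hGc : Continuous G := by
    have h := continuous_parametric_integral_of_continuous (μ := μ.toSphere)
      (f := fun (r : ℝ) (ω : Metric.sphere (0 : E) 1) => f (r • ω.1))
      (by fun_prop) isCompact_univ
    simp only [Measure.restrict_univ] at h
    fun_prop
  have hshell : ∀ ε ∈ Ioo (0 : ℝ) 1, ∫ x in {x | |1 - ‖x‖| < ε}, f x ∂μ =
      ∫ r in (1 - ε)..(1 + ε), G r := by
    rintro ε ⟨h0, h1⟩
    have hm : MeasurableSet {x : E | |1 - ‖x‖| < ε} :=
      measurableSet_lt (by fun_prop) measurable_const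
    have hi : IntegrableOn f {x : E | |1 - ‖x‖| < ε} μ := by
      refine (hf.continuousOn.integrableOn_compact
        (isCompact_closedBall (0 : E) 2)).mono_set fun x hx => ?_
      have := (abs_lt.1 (show |1 - ‖x‖| < ε from hx)).1
      rw [mem_closedBall_zero_iff]
      linarith
    rw [← integral_indicator hm, integral_polar μ _ ((integrable_indicator_iff hm).2 hi),
      intervalIntegral.integral_of_le (by linarith), integral_Ioc_eq_integral_Ioo,
      ← integral_indicator measurableSet_Ioi, ← integral_indicator measurableSet_Ioo]
    congr 1
    ext1 r
    by_cases hr : 0 < r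
    · have e : ∀ ω : Metric.sphere (0 : E) 1, ‖r • ω.1‖ = r := fun ω => by
        rw [norm_smul, norm_eq_of_mem_sphere ω, mul_one, Real.norm_of_nonneg hr.le]
      by_cases hr2 : |1 - r| < ε
      · have h3 : r ∈ Ioo (1 - ε) (1 + ε) := by
          rw [abs_lt] at hr2; constructor <;> linarith
        rw [indicator_of_mem (mem_Ioi.2 hr), indicator_of_mem h3, hG]
        simp only [indicator, mem_ofPred_eq, e, hr2, if_true]
      · have h3 : r ∉ Ioo (1 - ε) (1 + ε) := fun h => hr2 (by
          rw [abs_lt]; constructor <;> linarith [h.1, h.2])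
        rw [indicator_of_mem (mem_Ioi.2 hr), indicator_of_notMem h3]
        simp [indicator, e, hr2]
    · rw [indicator_of_notMem (fun h => hr (mem_Ioi.1 h)),
        indicator_of_notMem fun h => hr (by linarith [h.1])]
  have hF : ∀ x, HasDerivAt (fun u => ∫ r in (0 : ℝ)..u, G r) (G x) x := fun x =>
    hGc.integral_hasStrictDerivAt 0 x |>.hasDerivAt
  have hK : HasDerivAt (fun ε : ℝ => ∫ r in (1 - ε)..(1 + ε), G r) ((2 : ℝ) • G 1) 0 := by
    have e : (fun ε : ℝ => ∫ r in (1 - ε)..(1 + ε), G r) =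
        fun ε => (∫ r in (0 : ℝ)..(1 + ε), G r) - ∫ r in (0 : ℝ)..(1 - ε), G r := by
      ext1 ε
      rw [intervalIntegral.integral_interval_sub_left] <;> exact hGc.intervalIntegrable _ _
    rw [e]
    have d1 := HasDerivAt.scomp (0 : ℝ) (h := fun ε : ℝ => 1 + ε) (hF _)
      ((hasDerivAt_id (0 : ℝ)).const_add 1)
    have d2 := HasDerivAt.scomp (0 : ℝ) (h := fun ε : ℝ => 1 - ε) (hF _)
      ((hasDerivAt_id (0 : ℝ)).const_sub 1)
    refine (d1.sub d2).congr_deriv ?_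
    simp [two_smul]
  have hlim := (hasDerivAt_iff_tendsto_slope_zero.1 hK).mono_left
    (nhdsWithin_mono 0 fun x (hx : 0 < x) => hx.ne')
  have hlim2 := hlim.const_smul (2⁻¹ : ℝ)
  have hG1 : (2⁻¹ : ℝ) • (2 : ℝ) • G 1 = ∫ ω, f ω.1 ∂μ.toSphere := by
    simp [hG, smul_smul]
  rw [hG1] at hlim2
  refine hlim2.congr' ?_
  filter_upwards [Ioo_mem_nhdsGT (zero_lt_one' ℝ)] with ε hε
  rw [hshell ε hε, smul_smul, mul_inv]
  simp

/-- The generalized density `δ(1 - ω)`: the image of the surface measure of the unit sphere under the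
affine map `meanVec`, multiplied by the Jacobian `√(det T)` of this map. -/
def ellipsoidDelta (a₀ b₀ c₀ : ℝ) (a b c : EuclideanSpace ℝ (Fin 3)) : Measure (ℝ × ℝ × ℝ) :=
  ENNReal.ofReal √(gramABC a b c).det •
    ((volume : Measure (EuclideanSpace ℝ (Fin 3))).toSphere.map Subtype.val).map
      (meanVec a₀ b₀ c₀ a b c)

lemma continuous_meanVec (a₀ b₀ c₀ : ℝ) (a b c : EuclideanSpace ℝ (Fin 3)) :
    Continuous (meanVec a₀ b₀ c₀ a b c) := by
  unfold meanVec; fun_prop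

/-- The map `meanVec` carries the shells `| |n| - 1 | < ε` to the sets `|1 - ω| < ε`. -/
theorem isDeltaComp_ellipsoidDelta (a₀ b₀ c₀ : ℝ) {a b c : EuclideanSpace ℝ (Fin 3)}
    (h : (rowMatrix a b c).det ≠ 0) :
    IsDeltaComp (fun p => 1 - omegaABC a₀ b₀ c₀ a b c p) (ellipsoidDelta a₀ b₀ c₀ a b c) := by
  have hM := continuous_meanVec a₀ b₀ c₀ a b c
  have hd : 0 < |(rowMatrix a b c).det| := abs_pos.2 h
  constructor
  · rw [ellipsoidDelta]
    have : IsFiniteMeasure (ENNReal.ofReal √(gramABC a b c).det •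
      ((volume : Measure (EuclideanSpace ℝ (Fin 3))).toSphere.map Subtype.val).map
      (meanVec a₀ b₀ c₀ a b c)) := Measure.smul_finite _ ENNReal.ofReal_ne_top
    infer_instance
  · intro φ hφ _
    have hlim := (tendsto_integral_shell (volume : Measure (EuclideanSpace ℝ (Fin 3)))
      (hφ.comp hM)).const_mul |(rowMatrix a b c).det|
    have hint : ∫ p, φ p ∂(ellipsoidDelta a₀ b₀ c₀ a b c) = |(rowMatrix a b c).det| *
        ∫ ω, (φ ∘ meanVec a₀ b₀ c₀ a b c) ω.1
          ∂(volume : Measure (EuclideanSpace ℝ (Fin 3))).toSphere := by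
      rw [ellipsoidDelta, integral_smul_measure, sqrt_det_gramABC, ENNReal.toReal_ofReal hd.le,
        integral_map hM.measurable.aemeasurable hφ.aestronglyMeasurable,
        integral_map (f := fun x => φ (meanVec a₀ b₀ c₀ a b c x))
          measurable_subtype_coe.aemeasurable (hφ.comp hM).aestronglyMeasurable]
      rfl
    rw [hint]
    refine hlim.congr fun ε => ?_
    have hω : Measurable (omegaABC a₀ b₀ c₀ a b c) := by
      unfold omegaABC
      simp only [dotProduct, mulVec, Fin.sum_univ_three]
      simp
      fun_prop
    have hm : MeasurableSet {p | |1 - omegaABC a₀ b₀ c₀ a b c p| < ε} :=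
      measurableSet_lt (by fun_prop) measurable_const
    have h1 := setIntegral_map (μ := (volume : Measure (EuclideanSpace ℝ (Fin 3)))) hm
      (hφ.aestronglyMeasurable) hM.measurable.aemeasurable
    rw [map_meanVec_volume _ _ _ h, Measure.restrict_smul, integral_smul_measure,
      ENNReal.toReal_ofReal (by positivity)] at h1
    have h2 : meanVec a₀ b₀ c₀ a b c ⁻¹' {p | |1 - omegaABC a₀ b₀ c₀ a b c p| < ε} =
        {x | |1 - ‖x‖| < ε} := by
      ext x
      simp [omegaABC_meanVec _ _ _ h]
    rw [h2] at h1
    simp only [Function.comp_apply, ← h1, smul_eq_mul]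
    field_simp

theorem meanDensity_formula (a₀ b₀ c₀ : ℝ) {a b c : EuclideanSpace ℝ (Fin 3)}
    (h : (rowMatrix a b c).det ≠ 0) :
    meanDensity (qubitObs a₀ a) (qubitObs b₀ b) (qubitObs c₀ c) =
      ENNReal.ofReal (1 / (4 * Real.pi * √(gramABC a b c).det)) •
        ellipsoidDelta a₀ b₀ c₀ a b c := by
  have hd : 0 < √(gramABC a b c).det := by rw [sqrt_det_gramABC]; exact abs_pos.2 h
  rw [meanDensity_qubitObs, blochLaw_eq, Measure.map_smul, ellipsoidDelta, smul_smul,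
    ← ENNReal.ofReal_mul (by positivity), ← ENNReal.ofReal_inv_of_pos (by positivity)]
  congr 2
  field_simp

end

theorem mainTheorem5 (a₀ b₀ c₀ : ℝ) (a b c : EuclideanSpace ℝ (Fin 3))
    (ha : a ≠ 0) (hb : b ≠ 0) (hc : c ≠ 0) :
    uncertaintyDensity (qubitObs a₀ a) (qubitObs b₀ b) (qubitObs c₀ c) =
      (∑ j : ℤˣ, ∑ k : ℤˣ,
        substDensity (meanDensity (qubitObs a₀ a) (qubitObs b₀ b) (qubitObs c₀ c))
          (Set.Ioo 0 ‖a‖ ×ˢ Set.Ioo 0 ‖b‖ ×ˢ Set.Ioo 0 ‖c‖)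
          (fun p => (branch a₀ ‖a‖ 1 p.1, branch b₀ ‖b‖ j p.2.1, branch c₀ ‖c‖ k p.2.2))).withDensity
        (fun p => ENNReal.ofReal (2 * p.1 * p.2.1 * p.2.2 /
          √((‖a‖ ^ 2 - p.1 ^ 2) * (‖b‖ ^ 2 - p.2.1 ^ 2) * (‖c‖ ^ 2 - p.2.2 ^ 2)))) ∧
    (LinearIndependent ℝ ![a, b, c] →
      ∃ δω : Measure (ℝ × ℝ × ℝ),
        IsDeltaComp (fun p => 1 - omegaABC a₀ b₀ c₀ a b c p) δω ∧
        meanDensity (qubitObs a₀ a) (qubitObs b₀ b) (qubitObs c₀ c) =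
          ENNReal.ofReal (1 / (4 * Real.pi * √(gramABC a b c).det)) • δω) := by
  refine ⟨uncertaintyDensity_formula a₀ b₀ c₀ ha hb hc, fun hli => ?_⟩
  have hdet := det_rowMatrix_ne_zero hli
  exact ⟨ellipsoidDelta a₀ b₀ c₀ a b c, isDeltaComp_ellipsoidDelta a₀ b₀ c₀ hdet,
    meanDensity_formula a₀ b₀ c₀ hdet⟩
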